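/- All graphs are finite and simple. For a graph $G$ and a weighing $w:E(G)\to\{-1,1\}$ let $w(G)=\sum_{e\in E(G)}w(e)$, and define the weight of a subgraph likewise. For a positive integer $k$, call $w$ $k$-local positive if every connected subgraph of $G$ with exactly $k$ edges has positive weight. Let $\mathcal G$ be an infinite family of connected graphs (considered up to isomorphism). We say that $k$ is forcing for $\mathcal G$ if, for all but finitely many $G\in\mathcal G$, every $k$-local positive weighing $w$ of $G$ satisfies $w(G)>0$. If $k$ is not forcing, we say that $k$ is weakly forcing for $\mathcal G$ if there is a constant $C$ such that, for all but finitely many $G\in\mathcal G$, every $k$-local positive weighing $w$ of $G$ satisfies $w(G)\ge C$; the maximum such $C$ is denoted by $f_{\mathcal G}(k)$. If $k$ is neither forcing nor weakly forcing, we say that $k$ collapses for $\mathcal G$; then $c_{\mathcal G}(k)$ denotes the supremum of all $c\le 0$ such that $w(G)\ge c|E(G)|-o(|E(G)|)$ for all $G\in\mathcal G$ and all $k$-local positive weighings $w$ of $G$. **Theorem.** Let $\mathcal G$ be a family of connected graphs that contains all trees. Then: 1. $k=1,2,4$ are forcing for $\mathcal G$. 2. $k=3,5,6,8$ are weakly forcing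 for $\mathcal G$, with $f_{\mathcal G}(3)=0$, $f_{\mathcal G}(5)=-1$, $f_{\mathcal G}(6)=0$, $f_{\mathcal G}(8)=-1$. 3. $k=7$ and all $k\ge 9$ collapse for $\mathcal G$. Furthermore, for such $k$: - (a) if $k=4m+3$, then $c_{\mathcal G}(k)=-\frac{m}{3m+2}$; - (b) if $k=4m+2$, then $c_{\mathcal G}(k)=-\frac{m-1}{3m+1}$; - (c) if $k=4m+1$, then $-\frac{m-1}{3m+1}\ge c_{\mathcal G}(k)\ge-\frac{2m-1}{6m+1}$; - (d) if $k=4m$, then $-\frac{m-2}{3m}\ge c_{\mathcal G}(k)\ge-\frac{2m-3}{6m-1}$. -/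

import Mathlib

open Filter Asymptotics

/-- A finite simple graph, presented on the vertex set `Fin n`. Every isomorphism class of finite
graphs has at least one and only finitely many such presentations, so "finitely many graphs" has
the same meaning for presented graphs and for isomorphism classes. -/
abbrev FinGraph : Type := Σ n : ℕ, SimpleGraph (Fin n)

namespace FinGraph

/-- The family of all (finite) connected graphs. -/
def connectedGraphs : Set FinGraph := {G | G.2.Connected}

/-- The family of all (finite) trees. -/
def trees : Set FinGraph := {G | G.2.IsTree}

/-- A `{-1, 1}`-weighing of the edges of `G`; the values of `w` on pairs that are not edges of `G`
play no role anywhere. -/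
def IsWeighing (G : FinGraph) (w : Sym2 (Fin G.1) → ℤ) : Prop :=
  ∀ e ∈ G.2.edgeSet, w e = -1 ∨ w e = 1

open scoped Classical in
/-- The total weight of a set of edges. -/
noncomputable def weight {n : ℕ} (w : Sym2 (Fin n) → ℤ) (S : Set (Sym2 (Fin n))) : ℤ :=
  ∑ e with e ∈ S, w e

/-- The number of edges of `G`. -/
noncomputable def numEdges (G : FinGraph) : ℕ := G.2.edgeSet.ncard

/-- `w` is a weighing of `G` that is positive on every connected subgraph with `k` edges. -/
def IsLocalPositive (k : ℕ) (G : FinGraph) (w : Sym2 (Fin G.1) → ℤ) : Prop :=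
  IsWeighing G w ∧
    ∀ H : G.2.Subgraph, H.Connected → H.edgeSet.ncard = k → 0 < weight w H.edgeSet

/-- `k` is forcing for `𝒢`: for all but finitely many `G ∈ 𝒢`, every `k`-local positive weighing
of `G` has positive total weight. -/
def Forcing (𝒢 : Set FinGraph) (k : ℕ) : Prop :=
  {G ∈ 𝒢 | ¬ ∀ w, IsLocalPositive k G w → 0 < weight w G.2.edgeSet}.Finite

/-- For all but finitely many `G ∈ 𝒢`, every `k`-local positive weighing of `G` has total weight
at least `C`. -/
def BoundedBelowBy (𝒢 : Set FinGraph) (k : ℕ) (C : ℝ) : Prop :=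
  {G ∈ 𝒢 | ¬ ∀ w, IsLocalPositive k G w → C ≤ (weight w G.2.edgeSet : ℝ)}.Finite

/-- `k` is weakly forcing for `𝒢`. -/
def WeaklyForcing (𝒢 : Set FinGraph) (k : ℕ) : Prop :=
  ¬ Forcing 𝒢 k ∧ ∃ C : ℝ, BoundedBelowBy 𝒢 k C

/-- `f_𝒢(k) = C`: the largest constant `C` for which `BoundedBelowBy 𝒢 k C` holds is attained
and equals the given one. -/
def IsForcingConstant (𝒢 : Set FinGraph) (k : ℕ) (C : ℝ) : Prop :=
  IsGreatest {C' : ℝ | BoundedBelowBy 𝒢 k C'} C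

/-- `k` collapses for `𝒢`: it is neither forcing nor weakly forcing. -/
def Collapses (𝒢 : Set FinGraph) (k : ℕ) : Prop :=
  ¬ Forcing 𝒢 k ∧ ¬ WeaklyForcing 𝒢 k

/-- The real numbers `c ≤ 0` such that `w(G) ≥ c |E(G)| - o(|E(G)|)` for all `G ∈ 𝒢` and all
`k`-local positive weighings `w` of `G`. -/
def linearBounds (𝒢 : Set FinGraph) (k : ℕ) : Set ℝ :=
  {c | c ≤ 0 ∧ ∃ h : ℕ → ℝ, h =o[atTop] (fun n : ℕ => (n : ℝ)) ∧
    ∀ G ∈ 𝒢, ∀ w, IsLocalPositive k G w →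
      c * (numEdges G : ℝ) - h (numEdges G) ≤ (weight w G.2.edgeSet : ℝ)}

/-- The constant `c_𝒢(k)`. -/
noncomputable def collapseConstant (𝒢 : Set FinGraph) (k : ℕ) : ℝ := sSup (linearBounds 𝒢 k)

theorem neg_one_mem_linearBounds (𝒢 : Set FinGraph) (k : ℕ) : (-1 : ℝ) ∈ linearBounds 𝒢 k := by
  classical
  refine ⟨by norm_num, fun _ => 0, isLittleO_zero _ _, fun G _ w hw => ?_⟩
  have h1 : -(numEdges G : ℤ) ≤ weight w G.2.edgeSet := by
    have hc : numEdges G = (Finset.univ.filter (fun e => e ∈ G.2.edgeSet)).card := by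
      rw [numEdges, ← Set.ncard_coe_finset]
      congr 1
      ext e
      simp
    have h2 := Finset.card_nsmul_le_sum (Finset.univ.filter (fun e => e ∈ G.2.edgeSet)) w (-1)
      (fun e he => by
        have he' : e ∈ G.2.edgeSet := (Finset.mem_filter.mp he).2
        rcases hw.1 e he' with h | h <;> omega)
    rw [← hc] at h2
    have h3 : weight w G.2.edgeSet
        = ∑ e ∈ Finset.univ.filter (fun e => e ∈ G.2.edgeSet), w e := by
      unfold weight
      congr!
    rw [h3]
    simpa using h2
  have h4 : -(numEdges G : ℝ) ≤ (weight w G.2.edgeSet : ℝ) := by exact_mod_cast h1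
  simpa using h4

/-- The supremum defining `c_𝒢(k)` is a genuine one. -/
theorem isLUB_collapseConstant (𝒢 : Set FinGraph) (k : ℕ) :
    IsLUB (linearBounds 𝒢 k) (collapseConstant 𝒢 k) :=
  isLUB_csSup ⟨-1, neg_one_mem_linearBounds 𝒢 k⟩ ⟨0, fun _ hc => hc.1⟩

end FinGraph

/-!
Fix `k` and write `k = t + s` with `t = (k - 1) / 2`, so `s` is `t + 1` or `t + 2`. A weighing of a
connected graph with at least `k` edges is `k`-local positive exactly if every connected subgraph
with more than `t` negative edges has at least `s` positive ones: a counterexample could be grown or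
shrunk to one with exactly `k` edges. The direction needed here is `IsLocalPositive.separated`.

*Lower bounds.* A connected subgraph with more than `t` and at most `2 * t` negative edges has at
least `s / (2 * t)` positive edges per negative one. Rooting the graph and cutting off such pieces
from the far end partitions the edges into pieces of this kind, except for a remainder with at most
`t` negative edges (`RootedConn.exists_remainder`). Hence `2 t P ≥ s (N - t)` for the numbers `P`
and `N` of positive and negative edges. This settles `k = 4` and gives the bound
`(s - 2 * t) / (s + 2 * t)` for the collapse constant. For `k = 3, 6` we have `s = 2 * t`, for
`k = 5, 8` we have `s = 2 * t - 1`, and the sharp bound is `N - P ≤ 2 * t - s`. It follows by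
induction (`RootedConn.negCount_le`): the graph splits at a vertex into two pieces that together
have just become too negative and a rest. If the rest is too negative as well, induction applies to
it, with or without one of the pieces; otherwise any two of the three pieces either have at least
`s` positive edges or at most `t` negative ones. For `k = 1, 2` no edge can be negative.

*Upper bounds.* In a spider whose legs are positive paths ending in `t` negative leaves each, a
connected subgraph with more than `t` negative edges meets the leaves of two legs and so contains
both of their paths. It thus suffices that any two paths have at least `s` edges in total: one path
may have `⌊s / 2⌋` edges if all others have `⌈s / 2⌉` (`exists_spider_weight`).
-/

namespace FinGraph

/-! ### Rooted connected edge sets -/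

section Rooted

variable {V : Type*} [DecidableEq V] {G : SimpleGraph V}

/-- `RootedConn G v U S`: the finite set `S` of edges of `G` together with the vertex set `U` forms
a connected subgraph containing the root `v`. Such a subgraph is generated from one-vertex graphs by
gluing two edge-disjoint pieces at their common root and by hanging a piece on a new edge that leads
to a new root. The vertex sets of glued pieces may overlap outside the root, so cycles are
allowed. -/
inductive RootedConn (G : SimpleGraph V) : V → Finset V → Finset (Sym2 V) → Prop
  | nil (v : V) : RootedConn G v {v} ∅
  | join {v : V} {U U' : Finset V} {S S' : Finset (Sym2 V)} :
      RootedConn G v U S → RootedConn G v U' S' → Disjoint S S' →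
      RootedConn G v (U ∪ U') (S ∪ S')
  | stem {v u : V} {U : Finset V} {S : Finset (Sym2 V)} :
      G.Adj v u → RootedConn G u U S → s(v, u) ∉ S →
      RootedConn G v (insert v U) (insert s(v, u) S)

namespace RootedConn

variable {v x : V} {U U' : Finset V} {S S' : Finset (Sym2 V)}

theorem root_mem (h : RootedConn G v U S) : v ∈ U := by
  induction h with
  | nil v => simp
  | join _ _ _ ih _ => exact Finset.mem_union_left _ ih
  | stem _ _ _ _ => exact Finset.mem_insert_self _ _

theorem mem_edgeSet (h : RootedConn G v U S) : ∀ e ∈ S, e ∈ G.edgeSet := by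
  induction h with
  | nil v => simp
  | join _ _ _ ih ih' =>
    intro e he
    rcases Finset.mem_union.1 he with he | he
    exacts [ih e he, ih' e he]
  | stem hadj _ _ ih =>
    intro e he
    rcases Finset.mem_insert.1 he with rfl | he
    exacts [hadj, ih e he]

theorem mem_verts (h : RootedConn G v U S) : ∀ e ∈ S, ∀ a ∈ e, a ∈ U := by
  induction h with
  | nil v => simp
  | join _ _ _ ih ih' =>
    intro e he a ha
    rcases Finset.mem_union.1 he with he | he
    exacts [Finset.mem_union_left _ (ih e he a ha), Finset.mem_union_right _ (ih' e he a ha)]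
  | stem _ hR _ ih =>
    intro e he a ha
    rcases Finset.mem_insert.1 he with rfl | he
    · rcases Sym2.mem_iff.1 ha with rfl | rfl
      exacts [Finset.mem_insert_self _ _, Finset.mem_insert_of_mem hR.root_mem]
    · exact Finset.mem_insert_of_mem (ih e he a ha)

theorem single (hadj : G.Adj v x) : RootedConn G v {v, x} {s(v, x)} := by
  simpa using stem hadj (nil x) (by simp)

theorem graft (h : RootedConn G v U S) (hx : x ∈ U) (h' : RootedConn G x U' S')
    (hd : Disjoint S S') : RootedConn G v (U ∪ U') (S ∪ S') := by
  induction h with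
  | nil v =>
    obtain rfl : x = v := by simpa using hx
    exact join (nil x) h' hd
  | @join v U₁ U₂ S₁ S₂ h₁ h₂ h₁₂ ih₁ ih₂ =>
    rw [Finset.disjoint_union_left] at hd
    rcases Finset.mem_union.1 hx with hx | hx
    · rw [Finset.union_right_comm, Finset.union_right_comm S₁]
      exact join (ih₁ hx hd.1) h₂ (Finset.disjoint_union_left.2 ⟨h₁₂, hd.2.symm⟩)
    · rw [Finset.union_assoc, Finset.union_assoc]
      exact join h₁ (ih₂ hx hd.2) (Finset.disjoint_union_right.2 ⟨h₁₂, hd.1⟩)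
  | @stem v u U₁ S₁ hadj h₁ he ih =>
    rcases Finset.mem_insert.1 hx with rfl | hx
    · exact join (stem hadj h₁ he) h' hd
    · rw [Finset.disjoint_insert_left] at hd
      rw [Finset.insert_union, Finset.insert_union]
      exact stem hadj (ih hx hd.2) (by simp [he, hd.1])

theorem exists_subset_card (h : RootedConn G v U S) {k : ℕ} (hk : k ≤ S.card) :
    ∃ U' S', S' ⊆ S ∧ RootedConn G v U' S' ∧ S'.card = k := by
  induction h generalizing k with
  | nil v => exact ⟨_, _, subset_rfl, nil v, by simp at hk ⊢; omega⟩
  | @join v U₁ U₂ S₁ S₂ h₁ h₂ h₁₂ ih₁ ih₂ =>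
    rw [Finset.card_union_of_disjoint h₁₂] at hk
    obtain ⟨U₁', S₁', hs₁, hR₁, hc₁⟩ := ih₁ (k := min k S₁.card) (by omega)
    obtain ⟨U₂', S₂', hs₂, hR₂, hc₂⟩ := ih₂ (k := k - min k S₁.card) (by omega)
    have hd := Finset.disjoint_of_subset_left hs₁ (Finset.disjoint_of_subset_right hs₂ h₁₂)
    exact ⟨_, _, Finset.union_subset_union hs₁ hs₂, join hR₁ hR₂ hd, by
      rw [Finset.card_union_of_disjoint hd]; omega⟩
  | @stem v u U₁ S₁ hadj h₁ he ih =>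
    rw [Finset.card_insert_of_notMem he] at hk
    cases k with
    | zero => exact ⟨_, ∅, by simp, nil v, rfl⟩
    | succ k =>
      obtain ⟨U', S', hs, hR, hc⟩ := ih (k := k) (by omega)
      have he' : s(v, u) ∉ S' := fun h => he (hs h)
      exact ⟨_, _, Finset.insert_subset_insert _ hs, stem hadj hR he', by
        rw [Finset.card_insert_of_notMem he', hc]⟩

theorem exists_insert (hG : G.Connected) (h : RootedConn G v U S)
    (hS : ∃ e ∈ G.edgeSet, e ∉ S) : ∃ e ∉ S, ∃ U', RootedConn G v U' (insert e S) := by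
  suffices hab : ∃ a b, a ∈ U ∧ G.Adj a b ∧ s(a, b) ∉ S by
    obtain ⟨a, b, ha, hadj, he⟩ := hab
    have hR := graft h ha (single hadj) (by simpa using he)
    rw [Finset.union_comm S, ← Finset.insert_eq] at hR
    exact ⟨_, he, _, hR⟩
  obtain ⟨e, heG, heS⟩ := hS
  induction e with
  | _ a b =>
    by_cases ha : a ∈ U
    · exact ⟨a, b, ha, heG, heS⟩
    · obtain ⟨p⟩ := hG.preconnected v a
      obtain ⟨d, -, hd₁, hd₂⟩ := p.exists_boundary_dart (U : Set V) h.root_mem ha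
      exact ⟨d.fst, d.snd, hd₁, d.adj, fun hd =>
        hd₂ (h.mem_verts _ hd _ (Sym2.mem_mk_right _ _))⟩

theorem exists_superset_card (hG : G.Connected) (E : Finset (Sym2 V))
    (hE : ∀ e, e ∈ E ↔ e ∈ G.edgeSet) {k : ℕ} (hk : k ≤ E.card) (h : RootedConn G v U S)
    (hSk : S.card ≤ k) : ∃ U' S', S ⊆ S' ∧ RootedConn G v U' S' ∧ S'.card = k := by
  obtain ⟨d, hd⟩ := Nat.exists_eq_add_of_le hSk
  induction d generalizing U S with
  | zero => exact ⟨U, S, subset_rfl, h, by omega⟩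
  | succ d ih =>
    have hS : ∃ e ∈ G.edgeSet, e ∉ S := by
      obtain ⟨e, heE, heS⟩ := Finset.exists_mem_notMem_of_card_lt_card (s := S) (t := E) (by omega)
      exact ⟨e, (hE e).1 heE, heS⟩
    obtain ⟨e, he, U₁, h₁⟩ := exists_insert hG h hS
    have hc := Finset.card_insert_of_notMem he
    obtain ⟨U', S', hs, hR, hk'⟩ := ih h₁ (by omega) (by omega)
    exact ⟨U', S', (Finset.subset_insert _ _).trans hs, hR, hk'⟩

theorem exists_edgeFinset (hG : G.Connected) (E : Finset (Sym2 V))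
    (hE : ∀ e, e ∈ E ↔ e ∈ G.edgeSet) (v : V) : ∃ U, RootedConn G v U E := by
  obtain ⟨U, S, -, hR, hc⟩ := exists_superset_card hG E hE le_rfl (nil v) (by simp)
  rw [Finset.eq_of_subset_of_card_le (fun e he => (hE e).2 (hR.mem_edgeSet e he)) hc.ge] at hR
  exact ⟨U, hR⟩

theorem exists_subgraph (h : RootedConn G v U S) :
    ∃ H : G.Subgraph, H.Connected ∧ H.verts = U ∧ H.edgeSet = S := by
  induction h with
  | nil v => exact ⟨G.singletonSubgraph v, SimpleGraph.Subgraph.singletonSubgraph_connected,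
      by simp, by simp⟩
  | @join v _ _ _ _ h₁ h₂ _ ih₁ ih₂ =>
    obtain ⟨H₁, hc₁, hv₁, he₁⟩ := ih₁
    obtain ⟨H₂, hc₂, hv₂, he₂⟩ := ih₂
    refine ⟨H₁ ⊔ H₂,
      SimpleGraph.Subgraph.connected_sup hc₁.preconnected hc₂.preconnected
      ⟨v, ?_, ?_⟩, by simp [hv₁, hv₂], by simp [he₁, he₂]⟩
    · rw [hv₁]; exact h₁.root_mem
    · rw [hv₂]; exact h₂.root_mem
  | @stem v u U₁ S₁ hadj h₁ he ih =>
    obtain ⟨H, hc, hv, he⟩ := ih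
    refine ⟨G.subgraphOfAdj hadj ⊔ H,
      SimpleGraph.Subgraph.connected_sup
        (SimpleGraph.Subgraph.subgraphOfAdj_connected hadj).preconnected hc.preconnected
        ⟨u, by simp, ?_⟩, ?_, ?_⟩
    · rw [hv]; exact h₁.root_mem
    · have := h₁.root_mem
      ext a
      simp only [SimpleGraph.Subgraph.verts_sup, SimpleGraph.subgraphOfAdj_verts, hv,
        Finset.coe_insert, Set.mem_union, Set.mem_insert_iff, Set.mem_singleton_iff,
        Finset.mem_coe]
      grind
    · rw [SimpleGraph.Subgraph.edgeSet_sup, SimpleGraph.edgeSet_subgraphOfAdj, he,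
        Finset.coe_insert, Set.insert_eq]

end RootedConn

end Rooted

/-! ### Counting negative and positive edges -/

section Counting

variable {V : Type*} {G : SimpleGraph V}

/-- The number of edges in `S` that satisfy `N`, thought of as the negative edges. -/
def negCount (N : Sym2 V → Prop) [DecidablePred N] (S : Finset (Sym2 V)) : ℕ := (S.filter N).card

/-- The number of edges in `S` that do not satisfy `N`, thought of as the positive edges. -/
def posCount (N : Sym2 V → Prop) [DecidablePred N] (S : Finset (Sym2 V)) : ℕ :=
  (S.filter fun e => ¬ N e).card

variable {N : Sym2 V → Prop} [DecidablePred N] {S S' : Finset (Sym2 V)} {e : Sym2 V}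

theorem negCount_add_posCount : negCount N S + posCount N S = S.card :=
  Finset.card_filter_add_card_filter_not N

@[simp] theorem negCount_empty : negCount N ∅ = 0 := rfl

@[simp] theorem posCount_empty : posCount N ∅ = 0 := rfl

theorem negCount_mono (h : S ⊆ S') : negCount N S ≤ negCount N S' :=
  Finset.card_le_card (Finset.filter_subset_filter _ h)

theorem posCount_mono (h : S ⊆ S') : posCount N S ≤ posCount N S' :=
  Finset.card_le_card (Finset.filter_subset_filter _ h)

theorem negCount_singleton_le : negCount N {e} ≤ 1 := Finset.card_filter_le _ _

theorem negCount_add_posCount_singleton : negCount N {e} + posCount N {e} = 1 :=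
  negCount_add_posCount.trans (Finset.card_singleton e)

variable [DecidableEq V]

theorem negCount_union (h : Disjoint S S') :
    negCount N (S ∪ S') = negCount N S + negCount N S' := by
  rw [negCount, Finset.filter_union,
    Finset.card_union_of_disjoint (Finset.disjoint_filter_filter h)]; rfl

theorem posCount_union (h : Disjoint S S') :
    posCount N (S ∪ S') = posCount N S + posCount N S' := by
  rw [posCount, Finset.filter_union,
    Finset.card_union_of_disjoint (Finset.disjoint_filter_filter h)]; rfl

theorem negCount_insert (h : e ∉ S) :
    negCount N (insert e S) = negCount N {e} + negCount N S := by
  rw [Finset.insert_eq, negCount_union (by simpa using h)]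

theorem posCount_insert (h : e ∉ S) :
    posCount N (insert e S) = posCount N {e} + posCount N S := by
  rw [Finset.insert_eq, posCount_union (by simpa using h)]

/-- Every connected edge set with more than `t` negative edges has at least `s` positive ones. -/
def Separated (G : SimpleGraph V) (N : Sym2 V → Prop) [DecidablePred N] (t s : ℕ) : Prop :=
  ∀ ⦃v : V⦄ ⦃U : Finset V⦄ ⦃S : Finset (Sym2 V)⦄, RootedConn G v U S → t < negCount N S →
    s ≤ posCount N S

variable {t s : ℕ}

/-- Splitting off connected pieces with more than `t` and at most `2 * t` negative edges, as long
as there are any, leaves a connected remainder `A` with at most `t` negative edges. -/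
theorem RootedConn.exists_remainder (ht : 1 ≤ t) (hH : Separated G N t s) {v : V} {U : Finset V}
    (h : RootedConn G v U S) :
    ∃ U' A, A ⊆ S ∧ RootedConn G v U' A ∧ negCount N A ≤ t ∧
      s * negCount N S + 2 * t * posCount N A ≤ 2 * t * posCount N S + s * negCount N A := by
  induction h with
  | nil v => exact ⟨_, ∅, subset_rfl, .nil v, by simp, le_rfl⟩
  | @join v U₁ U₂ S₁ S₂ h₁ h₂ h₁₂ ih₁ ih₂ =>
    obtain ⟨U₁', A₁, hs₁, hR₁, hn₁, hb₁⟩ := ih₁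
    obtain ⟨U₂', A₂, hs₂, hR₂, hn₂, hb₂⟩ := ih₂
    have hd := Finset.disjoint_of_subset_left hs₁ (Finset.disjoint_of_subset_right hs₂ h₁₂)
    have hR := RootedConn.join hR₁ hR₂ hd
    have hnA := negCount_union (N := N) hd
    have hpA := posCount_union (N := N) hd
    have hnS := negCount_union (N := N) h₁₂
    have hpS := posCount_union (N := N) h₁₂
    by_cases hA : negCount N (A₁ ∪ A₂) ≤ t
    · refine ⟨_, _, Finset.union_subset_union hs₁ hs₂, hR, hA, ?_⟩
      rw [hnA, hpA, hnS, hpS]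
      nlinarith
    -- The union has between `t + 1` and `2 * t` negative edges and is split off as one piece.
    · have hp := hH hR (not_le.1 hA)
      refine ⟨_, ∅, by simp, .nil v, by simp, ?_⟩
      rw [hnS, hpS, negCount_empty, posCount_empty]
      have e1 := Nat.mul_le_mul_left s (show negCount N (A₁ ∪ A₂) ≤ 2 * t by omega)
      have e2 := Nat.mul_le_mul_left (2 * t) hp
      rw [hnA] at e1
      rw [hpA] at e2
      nlinarith
  | @stem v u U₁ S₁ hadj h₁ he ih =>
    obtain ⟨U', A, hs, hR', hn, hb⟩ := ih
    have he' : s(v, u) ∉ A := fun h => he (hs h)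
    have hR := RootedConn.stem hadj hR' he'
    have hnA := negCount_insert (N := N) he'
    have hpA := posCount_insert (N := N) he'
    have hnS := negCount_insert (N := N) he
    have hpS := posCount_insert (N := N) he
    by_cases hA : negCount N (insert s(v, u) A) ≤ t
    · refine ⟨_, _, Finset.insert_subset_insert _ hs, hR, hA, ?_⟩
      rw [hnA, hpA, hnS, hpS]
      nlinarith
    -- The enlarged remainder has `t + 1 ≤ 2 * t` negative edges and is split off as one piece.
    · have hp := hH hR (not_le.1 hA)
      have h1 : negCount N {s(v, u)} ≤ 1 := negCount_singleton_le
      refine ⟨_, ∅, by simp, .nil v, by simp, ?_⟩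
      rw [hnS, hpS, negCount_empty, posCount_empty]
      have e1 := Nat.mul_le_mul_left s
        (show negCount N (insert s(v, u) A) ≤ 2 * t by omega)
      have e2 := Nat.mul_le_mul_left (2 * t) hp
      rw [hnA] at e1
      rw [hpA] at e2
      nlinarith

theorem RootedConn.mul_negCount_le (ht : 1 ≤ t) (hH : Separated G N t s) {v : V} {U : Finset V}
    (h : RootedConn G v U S) : s * negCount N S ≤ 2 * t * posCount N S + s * t := by
  obtain ⟨U', A, -, -, hn, hb⟩ := h.exists_remainder ht hH
  have := Nat.mul_le_mul_left s hn
  omega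

/-- A minimal connected edge set `A` at `x` with more than `t` negative edges: it consists of two
pieces at `x`, or of a single edge followed by a piece, where each piece has at most `t` negative
edges. -/
def IsMinimalBranch (G : SimpleGraph V) (N : Sym2 V → Prop) [DecidablePred N] (t : ℕ) (x : V)
    (A : Finset (Sym2 V)) : Prop :=
  t < negCount N A ∧
    ((∃ U₁ A₁ U₂ A₂, RootedConn G x U₁ A₁ ∧ RootedConn G x U₂ A₂ ∧ Disjoint A₁ A₂ ∧
        A = A₁ ∪ A₂ ∧ negCount N A₁ ≤ t ∧ negCount N A₂ ≤ t) ∨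
      (∃ u U' A', G.Adj x u ∧ RootedConn G u U' A' ∧ s(x, u) ∉ A' ∧ A = insert s(x, u) A' ∧
        negCount N A' ≤ t))

/-- A connected edge set with more than `t` negative edges splits into a minimal branch and a
connected rest that share a vertex; the rest keeps the root. -/
theorem RootedConn.exists_isMinimalBranch {v : V} {U : Finset V} (h : RootedConn G v U S)
    (hn : t < negCount N S) :
    ∃ x A UB B, IsMinimalBranch G N t x A ∧ RootedConn G x UB B ∧ v ∈ UB ∧ Disjoint A B ∧
      S = A ∪ B := by
  induction h with
  | nil v => simp at hn
  | @join v U₁ U₂ S₁ S₂ h₁ h₂ h₁₂ ih₁ ih₂ =>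
    by_cases hn₁ : t < negCount N S₁
    · obtain ⟨x, A, UB, B, hA, hB, hv, hd, rfl⟩ := ih₁ hn₁
      rw [Finset.disjoint_union_left] at h₁₂
      exact ⟨x, A, _, _, hA, hB.graft hv h₂ h₁₂.2, Finset.mem_union_left _ hv,
        Finset.disjoint_union_right.2 ⟨hd, h₁₂.1⟩, Finset.union_assoc _ _ _⟩
    by_cases hn₂ : t < negCount N S₂
    · obtain ⟨x, A, UB, B, hA, hB, hv, hd, rfl⟩ := ih₂ hn₂
      rw [Finset.disjoint_union_right] at h₁₂
      exact ⟨x, A, _, _, hA, hB.graft hv h₁ h₁₂.2.symm, Finset.mem_union_left _ hv,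
        Finset.disjoint_union_right.2 ⟨hd, h₁₂.1.symm⟩, by
          rw [Finset.union_comm, Finset.union_assoc]⟩
    · exact ⟨v, _, _, ∅, ⟨hn, .inl ⟨_, _, _, _, h₁, h₂, h₁₂, rfl, not_lt.1 hn₁, not_lt.1 hn₂⟩⟩,
        .nil v, by simp, by simp, by simp⟩
  | @stem v u U₁ S₁ hadj h₁ he ih =>
    by_cases hn₁ : t < negCount N S₁
    · obtain ⟨x, A, UB, B, hA, hB, hv, hd, rfl⟩ := ih hn₁
      rw [Finset.mem_union, not_or] at he
      have hR := hB.graft hv (.single hadj.symm) (by simpa [Sym2.eq_swap] using he.2)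
      exact ⟨x, A, _, _, hA, hR, by simp, by
        simpa [Finset.disjoint_union_right, Sym2.eq_swap] using ⟨he.1, hd⟩, by
        rw [← Finset.union_assoc, Finset.insert_eq, Finset.union_comm, Sym2.eq_swap]⟩
    · exact ⟨v, _, _, ∅, ⟨hn, .inr ⟨_, _, _, hadj, h₁, he, rfl, not_lt.1 hn₁⟩⟩,
        .nil v, by simp, by simp, by simp⟩

/-- If `s` is `2 * t` or `2 * t - 1`, a connected edge set with more than `t` negative edges has at
most `2 * t - s` more negative than positive ones. Split it into a minimal branch and a rest.
If the rest has more than `t` negative edges, induction applies to the rest, and also to its unions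
with either piece of the branch. Otherwise there are three pieces at one vertex, and `Separated`
applies to the pairs of pieces. -/
theorem RootedConn.negCount_le (hs : s ≤ 2 * t) (hts : 2 * t ≤ s + 1) (ht : t + 1 ≤ s)
    (hH : Separated G N t s) {v : V} {U : Finset V} (h : RootedConn G v U S)
    (hn : t < negCount N S) : negCount N S + s ≤ posCount N S + 2 * t := by
  induction hc : S.card using Nat.strong_induction_on generalizing v U S with
  | _ c ih =>
  subst hc
  obtain ⟨x, A, UB, B, ⟨hnA, hA⟩, hB, -, hd, rfl⟩ := h.exists_isMinimalBranch hn
  have hp := hH h hn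
  have hnS := negCount_union (N := N) hd
  have hpS := posCount_union (N := N) hd
  have hcS := Finset.card_union_of_disjoint hd
  have hcA := negCount_add_posCount (N := N) (S := A)
  have ihB := fun hnB => ih _ (by omega) hB hnB rfl
  rcases hA with ⟨U₁, A₁, U₂, A₂, hA₁, hA₂, h₁₂, rfl, hn₁, hn₂⟩ |
    ⟨u, U', A', hadj, hA', he, rfl, hn'⟩
  · have hpA := hH (hA₁.join hA₂ h₁₂) hnA
    rw [Finset.disjoint_union_left] at hd
    have e1 := negCount_union (N := N) h₁₂
    have e2 := posCount_union (N := N) h₁₂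
    have e3 := negCount_union (N := N) hd.1
    have e4 := posCount_union (N := N) hd.1
    have e5 := negCount_union (N := N) hd.2
    have e6 := posCount_union (N := N) hd.2
    have c1 := Finset.card_union_of_disjoint h₁₂
    have c2 := Finset.card_union_of_disjoint hd.1
    have c3 := Finset.card_union_of_disjoint hd.2
    have c4 := negCount_add_posCount (N := N) (S := A₁)
    have c5 := negCount_add_posCount (N := N) (S := A₂)
    by_cases hnB : t < negCount N B
    · have ih₁ := ih _ (by omega) (hA₁.join hB hd.1) (by omega) rfl
      have ih₂ := ih _ (by omega) (hA₂.join hB hd.2) (by omega) rfl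
      have ih₃ := ihB hnB
      omega
    · by_cases hS : negCount N (A₁ ∪ A₂ ∪ B) ≤ 2 * t
      · omega
      · have := hH (hA₁.join hB hd.1) (by omega)
        have := hH (hA₂.join hB hd.2) (by omega)
        omega
  · have hpA := hH (hA'.stem hadj he) hnA
    rw [Finset.disjoint_insert_left] at hd
    have e1 := negCount_insert (N := N) he
    have e2 := posCount_insert (N := N) he
    have e3 := negCount_add_posCount_singleton (N := N) (e := s(x, u))
    by_cases hnB : t < negCount N B
    · have := ihB hnB
      omega
    · by_cases hS : negCount N (insert s(x, u) A' ∪ B) ≤ 2 * t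
      · omega
      · -- Both pieces have `t` negative edges, and the edge between them is negative.
        have hdB : Disjoint B {s(x, u)} := by simpa using hd.1
        have e4 := negCount_union (N := N) hdB
        have e5 := posCount_union (N := N) hdB
        have := hH (hB.join (.single hadj) hdB) (by omega)
        omega

end Counting

/-! ### Lower bounds for locally positive weighings -/

section LowerBounds

theorem weight_coe {n : ℕ} (w : Sym2 (Fin n) → ℤ) (S : Finset (Sym2 (Fin n))) :
    weight w S = ∑ e ∈ S, w e := by
  unfold weight
  congr 1
  ext e
  simp

theorem weight_eq_posCount_sub_negCount {n : ℕ} {w : Sym2 (Fin n) → ℤ} {S : Finset (Sym2 (Fin n))}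
    (h : ∀ e ∈ S, w e = -1 ∨ w e = 1) :
    weight w S = posCount (w · = -1) S - negCount (w · = -1) S := by
  rw [weight_coe, ← Finset.sum_filter_add_sum_filter_not S (w · = -1),
    Finset.sum_congr rfl fun e he => (Finset.mem_filter.1 he).2,
    Finset.sum_congr rfl fun e he => (h e (Finset.mem_filter.1 he).1).resolve_left
      (Finset.mem_filter.1 he).2]
  simp [posCount, negCount]
  ring

/-- The edges of `G` as a `Finset`. -/
noncomputable def edges (G : FinGraph) : Finset (Sym2 (Fin G.1)) := G.2.edgeSet.toFinite.toFinset

@[simp] theorem coe_edges (G : FinGraph) : (G.edges : Set (Sym2 (Fin G.1))) = G.2.edgeSet := by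
  simp [edges]

theorem mem_edges {G : FinGraph} {e : Sym2 (Fin G.1)} : e ∈ G.edges ↔ e ∈ G.2.edgeSet := by
  simp [edges]

theorem card_edges (G : FinGraph) : G.edges.card = numEdges G :=
  (Set.ncard_eq_toFinset_card _ _).symm

variable {G : FinGraph} {w : Sym2 (Fin G.1) → ℤ} {k t s : ℕ}

/-- In a locally positive weighing a connected edge set with too many negative and too few positive
edges could be grown or shrunk to a connected subgraph with `k` edges and at most half of them
positive. -/
theorem IsLocalPositive.separated (hG : G.2.Connected) (hE : k ≤ numEdges G)
    (hk : k = t + s) (hst : s ≤ t + 2) (h : IsLocalPositive k G w) :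
    Separated G.2 (w · = -1) t s := by
  intro v U S hR hn
  by_contra! hp
  have key : ∃ v U S', RootedConn G.2 v U S' ∧ S'.card = k ∧ t < negCount (w · = -1) S' := by
    have hc := negCount_add_posCount (N := (w · = -1)) (S := S)
    rcases le_total S.card k with hSk | hSk
    · obtain ⟨U', S', hs, hR', hc'⟩ := hR.exists_superset_card hG G.edges (fun _ => mem_edges)
        (by rwa [card_edges]) hSk
      exact ⟨v, U', S', hR', hc', hn.trans_le (negCount_mono hs)⟩
    · obtain ⟨U', S', hs, hR', hc'⟩ := hR.exists_subset_card hSk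
      have h1 := posCount_mono (N := (w · = -1)) hs
      have h2 := negCount_add_posCount (N := (w · = -1)) (S := S')
      exact ⟨v, U', S', hR', hc', by omega⟩
  obtain ⟨v, U, S', hR', hc, hn'⟩ := key
  obtain ⟨H, hH, -, hHe⟩ := hR'.exists_subgraph
  have hw := h.2 H hH (by rw [hHe, Set.ncard_coe_finset, hc])
  rw [hHe, weight_eq_posCount_sub_negCount fun e he => h.1 e (hR'.mem_edgeSet e he)] at hw
  have := negCount_add_posCount (N := (w · = -1)) (S := S')
  omega

theorem IsWeighing.weight_eq (h : IsWeighing G w) :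
    weight w G.2.edgeSet = posCount (w · = -1) G.edges - negCount (w · = -1) G.edges := by
  rw [← weight_eq_posCount_sub_negCount fun e he => h e (mem_edges.1 he), coe_edges]

theorem negCount_add_posCount_edges :
    negCount (w · = -1) G.edges + posCount (w · = -1) G.edges = numEdges G := by
  rw [negCount_add_posCount, card_edges]

theorem exists_rootedConn_edges (hG : G.2.Connected) :
    ∃ v U, RootedConn G.2 v U G.edges :=
  have ⟨v⟩ := hG.nonempty
  ⟨v, RootedConn.exists_edgeFinset hG G.edges (fun _ => mem_edges) v⟩

theorem IsLocalPositive.mul_negCount_le (hG : G.2.Connected) (hE : k ≤ numEdges G)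
    (hk : k = t + s) (hst : s ≤ t + 2) (ht : 1 ≤ t) (h : IsLocalPositive k G w) :
    s * negCount (w · = -1) G.edges ≤ 2 * t * posCount (w · = -1) G.edges + s * t := by
  obtain ⟨v, U, hR⟩ := exists_rootedConn_edges hG
  exact hR.mul_negCount_le ht (h.separated hG hE hk hst)

theorem IsLocalPositive.le_weight (hG : G.2.Connected) (hE : k ≤ numEdges G)
    (hk : k = t + s) (hst : s ≤ t + 2) (hs : s ≤ 2 * t) (hts : 2 * t ≤ s + 1) (ht : t + 1 ≤ s)
    (h : IsLocalPositive k G w) : (s : ℤ) - 2 * t ≤ weight w G.2.edgeSet := by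
  obtain ⟨v, U, hR⟩ := exists_rootedConn_edges hG
  have hn := hR.negCount_le hs hts ht (h.separated hG hE hk hst)
  have hc := negCount_add_posCount_edges (w := w)
  rw [h.1.weight_eq]
  by_cases hnt : t < negCount (w · = -1) G.edges
  · have := hn hnt
    omega
  · omega

theorem IsLocalPositive.weight_pos_of_four (hG : G.2.Connected) (hE : 7 ≤ numEdges G)
    (h : IsLocalPositive 4 G w) : 0 < weight w G.2.edgeSet := by
  have h1 := h.mul_negCount_le (t := 1) (s := 3) hG (by omega) rfl (by norm_num) le_rfl
  have hc := negCount_add_posCount_edges (w := w)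
  rw [h.1.weight_eq]
  omega

/-- For `k = 1` and `k = 2` a single edge is already too many negative edges. -/
theorem IsLocalPositive.weight_pos_of_le_two (hk : 1 ≤ k) (hk2 : k ≤ 2) (hG : G.2.Connected)
    (hE : k ≤ numEdges G) (h : IsLocalPositive k G w) : 0 < weight w G.2.edgeSet := by
  have hsep := h.separated (t := 0) (s := k) hG hE (by omega) (by omega)
  have hn : negCount (w · = -1) G.edges = 0 := by
    rw [negCount, Finset.card_eq_zero, Finset.filter_eq_empty_iff]
    intro e he hwe
    induction e with
    | _ a b =>
      have := hsep (RootedConn.single (mem_edges.1 he)) (by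
        simp [negCount, Finset.filter_singleton, hwe])
      simp only [posCount, hwe, Finset.filter_singleton] at this
      simp at this
      omega
  have hc := negCount_add_posCount_edges (w := w)
  rw [h.1.weight_eq]
  omega

theorem IsWeighing.neg_numEdges_le (h : IsWeighing G w) :
    -(numEdges G : ℤ) ≤ weight w G.2.edgeSet := by
  rw [h.weight_eq]
  have hc := negCount_add_posCount_edges (w := w)
  omega

theorem mem_linearBounds {𝒢 : Set FinGraph} (hC : 𝒢 ⊆ connectedGraphs)
    (hk : k = t + s) (hst : s ≤ t + 2) (ht : 1 ≤ t) (hs : s ≤ 2 * t) :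
    ((s : ℝ) - 2 * t) / (s + 2 * t) ∈ linearBounds 𝒢 k := by
  have hsR : (s : ℝ) ≤ 2 * t := by exact_mod_cast hs
  have htR : (1 : ℝ) ≤ t := by exact_mod_cast ht
  have hs0 : (0 : ℝ) ≤ s := s.cast_nonneg
  have hpos : (0 : ℝ) < s + 2 * t := by linarith
  have hc : ((s : ℝ) - 2 * t) / (s + 2 * t) ≤ 0 :=
    div_nonpos_of_nonpos_of_nonneg (by linarith) hpos.le
  refine ⟨hc, fun _ => k + 2 * s * t, ?_, fun G hG w h => ?_⟩
  · exact isLittleO_const_left.2 (.inr (tendsto_norm_atTop_atTop.comp tendsto_natCast_atTop_atTop))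
  have hk0 : (0 : ℝ) ≤ k := k.cast_nonneg
  have hst0 : 0 ≤ 2 * (s : ℝ) * t := by positivity
  by_cases hE : k ≤ numEdges G
  · have h1 : (s : ℝ) * negCount (w · = -1) G.edges ≤
        2 * t * posCount (w · = -1) G.edges + s * t := by
      exact_mod_cast h.mul_negCount_le (hC hG) hE hk hst ht
    have h2 : (negCount (w · = -1) G.edges + posCount (w · = -1) G.edges : ℝ) = numEdges G := by
      exact_mod_cast negCount_add_posCount_edges
    rw [h.1.weight_eq, ← h2]
    push_cast
    rw [sub_le_iff_le_add, div_mul_eq_mul_div, div_le_iff₀ hpos]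
    have h3 : 2 * (s : ℝ) * t ≤ (k + 2 * s * t) * (s + 2 * t) := by
      calc 2 * (s : ℝ) * t ≤ (k + 2 * s * t) * 1 := by linarith
        _ ≤ _ := mul_le_mul_of_nonneg_left (by linarith) (by linarith)
    nlinarith
  · have h1 : -(numEdges G : ℝ) ≤ weight w G.2.edgeSet := by exact_mod_cast h.1.neg_numEdges_le
    have h2 : (numEdges G : ℝ) ≤ k := by exact_mod_cast (not_le.1 hE).le
    have h3 := mul_nonpos_of_nonpos_of_nonneg hc (numEdges G).cast_nonneg
    linarith

end LowerBounds

/-! ### Finitely many exceptions -/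

theorem finite_numEdges_lt (M : ℕ) : {G : FinGraph | G.2.Connected ∧ numEdges G < M}.Finite := by
  refine (Set.finite_range fun p : Σ n : Fin (M + 1), SimpleGraph (Fin n) =>
    (⟨p.1, p.2⟩ : FinGraph)).subset ?_
  rintro G ⟨hG, hE⟩
  have h : G.1 ≤ numEdges G + 1 := by
    simpa [numEdges, Nat.card_coe_set_eq] using hG.card_vert_le_card_edgeSet_add_one
  exact ⟨⟨⟨G.1, by omega⟩, G.2⟩, rfl⟩

theorem finite_of_numEdges_lt {𝒢 : Set FinGraph} (hC : 𝒢 ⊆ connectedGraphs) {P : FinGraph → Prop}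
    (M : ℕ) (h : ∀ G : FinGraph, G.2.Connected → M ≤ numEdges G → P G) :
    {G ∈ 𝒢 | ¬ P G}.Finite := by
  refine (finite_numEdges_lt M).subset fun G hG => ⟨hC hG.1, ?_⟩
  by_contra hM
  exact hG.2 (h G (hC hG.1) (not_lt.1 hM))

/-- If there are trees with arbitrarily many edges for which `P` fails, it fails for infinitely many
members of a family that contains all trees. -/
theorem infinite_of_trees {𝒢 : Set FinGraph} (hT : trees ⊆ 𝒢) {P : FinGraph → Prop}
    (h : ∀ M : ℕ, ∃ G ∈ trees, M ≤ numEdges G ∧ ¬ P G) : ¬ {G ∈ 𝒢 | ¬ P G}.Finite := by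
  intro hfin
  obtain ⟨B, hB⟩ := (hfin.image numEdges).bddAbove
  obtain ⟨G, hG, hM, hP⟩ := h (B + 1)
  have := hB ⟨G, ⟨hT hG, hP⟩, rfl⟩
  omega

/-! ### Trees given by a parent function -/

section ParentGraph

variable {V : Type*} {root : V} {par : V → V} {ht : V → ℕ}

/-- The graph in which every vertex other than `root` is joined to its parent. -/
def parentGraph (root : V) (par : V → V) : SimpleGraph V :=
  SimpleGraph.fromRel fun u v => u ≠ root ∧ par u = v

theorem parentGraph_adj (hpar : ∀ v ≠ root, ht (par v) < ht v) {a b : V} :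
    (parentGraph root par).Adj a b ↔ (a ≠ root ∧ par a = b) ∨ (b ≠ root ∧ par b = a) := by
  rw [parentGraph, SimpleGraph.fromRel_adj, and_iff_right_iff_imp]
  rintro (⟨h, rfl⟩ | ⟨h, rfl⟩) heq
  · exact (hpar a h).ne (congrArg ht heq.symm)
  · exact (hpar b h).ne (congrArg ht heq)

theorem injOn_parentEdge (hpar : ∀ v ≠ root, ht (par v) < ht v) :
    Set.InjOn (fun v => s(v, par v)) {v | v ≠ root} := by
  intro u hu v hv huv
  rcases Sym2.eq_iff.1 huv with ⟨h, -⟩ | ⟨h₁, h₂⟩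
  · exact h
  · have h1 := hpar u hu
    have h2 := hpar v hv
    rw [h₂] at h1
    rw [← h₁] at h2
    omega

theorem edgeSet_parentGraph (hpar : ∀ v ≠ root, ht (par v) < ht v) :
    (parentGraph root par).edgeSet = (fun v => s(v, par v)) '' {v | v ≠ root} := by
  ext e
  induction e with
  | _ a b =>
    rw [SimpleGraph.mem_edgeSet, parentGraph_adj hpar]
    constructor
    · rintro (⟨h, rfl⟩ | ⟨h, rfl⟩)
      exacts [⟨a, h, rfl⟩, ⟨b, h, Sym2.eq_swap⟩]
    · rintro ⟨v, hv, h⟩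
      rcases Sym2.eq_iff.1 h with ⟨rfl, rfl⟩ | ⟨rfl, rfl⟩
      exacts [.inl ⟨hv, rfl⟩, .inr ⟨hv, rfl⟩]

theorem ncard_edgeSet_parentGraph [Fintype V] (hpar : ∀ v ≠ root, ht (par v) < ht v) :
    (parentGraph root par).edgeSet.ncard + 1 = Fintype.card V := by
  have : {v | v ≠ root} = ({root} : Set V)ᶜ := rfl
  rw [edgeSet_parentGraph hpar, (injOn_parentEdge hpar).ncard_image, this,
    ← Nat.card_eq_fintype_card, ← Set.ncard_add_ncard_compl {root}, Set.ncard_singleton, add_comm]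

theorem isTree_parentGraph [Fintype V] (hpar : ∀ v ≠ root, ht (par v) < ht v) :
    (parentGraph root par).IsTree := by
  rw [SimpleGraph.isTree_iff_connected_and_card, Nat.card_coe_set_eq,
    ncard_edgeSet_parentGraph hpar, Nat.card_eq_fintype_card]
  refine ⟨SimpleGraph.connected_iff_exists_forall_reachable _ |>.2 ⟨root, fun v => ?_⟩, rfl⟩
  induction hv : ht v using Nat.strong_induction_on generalizing v with
  | _ n ih =>
    by_cases h : v = root
    · rw [h]
    · exact (ih _ (hv ▸ hpar v h) _ rfl).trans
        (SimpleGraph.Adj.reachable ((parentGraph_adj hpar).2 (.inr ⟨h, rfl⟩)))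

end ParentGraph

/-- A connected subgraph with vertices inside and outside of `D` has an edge leaving `D`. -/
theorem exists_adj_boundary {V : Type*} {G : SimpleGraph V} {H : G.Subgraph} (hH : H.Connected)
    (D : Set V) {x y : V} (hx : x ∈ H.verts) (hy : y ∈ H.verts) (hxD : x ∈ D) (hyD : y ∉ D) :
    ∃ a b, H.Adj a b ∧ a ∈ D ∧ b ∉ D := by
  obtain ⟨p⟩ := hH.preconnected ⟨x, hx⟩ ⟨y, hy⟩
  obtain ⟨d, -, h₁, h₂⟩ := p.exists_boundary_dart (Subtype.val ⁻¹' D) hxD hyD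
  exact ⟨_, _, d.adj, h₁, h₂⟩

/-! ### Spiders -/

section Spider

variable {J : Type*} {ℓ : J → ℕ} {t s : ℕ}

/-- The vertices of a spider with a leg for each `j : J`: the hub `none`, and on the leg `j` the
vertices `0, …, ℓ j - 1` of a path that starts next to the hub, followed by `t` leaves attached to
the end of this path. -/
abbrev SpiderVertex (ℓ : J → ℕ) (t : ℕ) : Type _ := Option (Σ j : J, Fin (ℓ j + t))

/-- The neighbour of a vertex of a spider in the direction of the hub. -/
def spiderParent : SpiderVertex ℓ t → SpiderVertex ℓ t
  | none => none
  | some ⟨j, r⟩ =>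
    if min r.1 (ℓ j) = 0 then none else some ⟨j, ⟨min r.1 (ℓ j) - 1, by omega⟩⟩

/-- The weight of the edge from a vertex of a spider to its parent: the leaves carry the negative
edges. The value at the hub, which has no parent, is chosen to be `0`. -/
def spiderWeight : SpiderVertex ℓ t → ℤ
  | none => 0
  | some ⟨j, r⟩ => if ℓ j ≤ r.1 then -1 else 1

/-- A strictly decreasing rank for `spiderParent`. -/
def spiderHeight : SpiderVertex ℓ t → ℕ
  | none => 0
  | some ⟨_, r⟩ => r.1 + 1

theorem spiderHeight_spiderParent_lt {x : SpiderVertex ℓ t} (hx : x ≠ none) :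
    spiderHeight (spiderParent x) < spiderHeight x := by
  obtain ⟨⟨j, r⟩, rfl⟩ := Option.ne_none_iff_exists'.1 hx
  simp only [spiderParent]
  split_ifs
  · simp [spiderHeight]
  · simp only [spiderHeight]
    omega

theorem sum_spiderWeight [Fintype J] :
    ∑ x : SpiderVertex ℓ t, spiderWeight x = ∑ j, ((ℓ j : ℤ) - t) := by
  rw [Fintype.sum_option, Fintype.sum_sigma]
  simp only [spiderWeight, zero_add]
  refine Finset.sum_congr rfl fun j _ => ?_
  rw [Fin.sum_univ_add]
  simp [sub_eq_add_neg, fun x : Fin (ℓ j) => not_le.2 x.2]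

/-- The part of the leg `i` that lies beyond its `q`-th vertex, this vertex included. -/
def legFrom (i : J) (q : ℕ) : Set (SpiderVertex ℓ t) :=
  {x | ∃ r : Fin (ℓ i + t), x = some ⟨i, r⟩ ∧ q ≤ r}

theorem eq_of_spiderParent_notMem_legFrom {i : J} {q : ℕ} (hq : q < ℓ i) {x : SpiderVertex ℓ t}
    (hx : x ∈ legFrom i q) (hpx : spiderParent x ∉ legFrom i q) :
    x = some ⟨i, ⟨q, by omega⟩⟩ := by
  obtain ⟨r, rfl, hr⟩ := hx
  by_cases h : r.1 = q
  · subst h; rfl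
  · refine absurd ?_ hpx
    rw [spiderParent, if_neg (by omega)]
    exact ⟨_, rfl, by simp only; omega⟩

theorem mem_legFrom_of_spiderParent {i : J} {q : ℕ} {x : SpiderVertex ℓ t}
    (hpx : spiderParent x ∈ legFrom i q) : x ∈ legFrom i q := by
  obtain ⟨r, hr, hqr⟩ := hpx
  match x, hr with
  | some ⟨j, r'⟩, hr =>
    simp only [spiderParent] at hr
    split_ifs at hr
    simp only [Option.some.injEq, Sigma.mk.injEq] at hr
    obtain ⟨rfl, hr⟩ := hr
    rw [heq_eq_eq] at hr
    subst hr
    exact ⟨r', rfl, by simp only at hqr; omega⟩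

variable {n : ℕ} (φ : Fin n ≃ SpiderVertex ℓ t)

/-- The spider, with its vertices numbered by `φ`. -/
abbrev spider : FinGraph := ⟨n, parentGraph (φ.symm none) fun v => φ.symm (spiderParent (φ v))⟩

/-- The edge of the spider between a vertex and its parent. -/
def spiderEdge (x : SpiderVertex ℓ t) : Sym2 (Fin n) := s(φ.symm x, φ.symm (spiderParent x))

open scoped Classical in
/-- The weighing of the spider for which exactly the edges at the leaves are negative. -/
noncomputable def spiderWeighing (e : Sym2 (Fin n)) : ℤ :=
  if ∃ x, x ≠ none ∧ e = spiderEdge φ x ∧ spiderWeight x = -1 then -1 else 1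

theorem height_lt : ∀ v ≠ φ.symm none,
    (spiderHeight ∘ φ) (φ.symm (spiderParent (φ v))) < (spiderHeight ∘ φ) v := by
  intro v hv
  simpa using spiderHeight_spiderParent_lt (x := φ v) fun h => hv (by rw [← h, φ.symm_apply_apply])

theorem spider_mem_trees : spider φ ∈ trees := isTree_parentGraph (height_lt φ)

theorem spiderEdge_injective {x y : SpiderVertex ℓ t} (hx : x ≠ none) (hy : y ≠ none)
    (h : spiderEdge φ x = spiderEdge φ y) : x = y := by
  refine φ.symm.injective (injOn_parentEdge (height_lt φ) (by simpa) (by simpa) ?_)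
  simpa [spiderEdge] using h

theorem edgeSet_spider : (spider φ).2.edgeSet = spiderEdge φ '' {x | x ≠ none} := by
  have h := edgeSet_parentGraph (height_lt φ)
  refine h.trans ?_
  ext e
  constructor
  · rintro ⟨v, hv, rfl⟩
    exact ⟨φ v, fun h => hv (by rw [← h, φ.symm_apply_apply]), by simp [spiderEdge]⟩
  · rintro ⟨x, hx, rfl⟩
    exact ⟨φ.symm x, by simpa using hx, by simp [spiderEdge]⟩

theorem spiderWeighing_spiderEdge {x : SpiderVertex ℓ t} (hx : x ≠ none) :
    spiderWeighing φ (spiderEdge φ x) = spiderWeight x := by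
  unfold spiderWeighing
  split_ifs with h
  · obtain ⟨y, hy, hxy, hw⟩ := h
    rw [spiderEdge_injective φ hx hy hxy, hw]
  · obtain ⟨⟨j, r⟩, rfl⟩ := Option.ne_none_iff_exists'.1 hx
    by_contra hne
    refine h ⟨_, hx, rfl, ?_⟩
    simp only [spiderWeight] at hne ⊢
    split_ifs at hne ⊢ <;> simp_all

theorem numEdges_spider [Fintype J] : numEdges (spider φ) = ∑ j, (ℓ j + t) := by
  have h := ncard_edgeSet_parentGraph (height_lt φ)
  rw [Fintype.card_congr φ, Fintype.card_option, Fintype.card_sigma] at h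
  simpa [numEdges] using h

theorem weight_spider [Fintype J] :
    weight (spiderWeighing φ) (spider φ).2.edgeSet = ∑ j, ((ℓ j : ℤ) - t) := by
  classical
  have he : (spider φ).2.edgeSet =
      ((Finset.univ.filter fun x : SpiderVertex ℓ t => x ≠ none).image (spiderEdge φ) :
        Finset (Sym2 (Fin n))) := by
    rw [edgeSet_spider]; simp
  rw [he, weight_coe, Finset.sum_image, ← sum_spiderWeight, Finset.sum_filter]
  · refine Finset.sum_congr rfl fun x _ => ?_
    split_ifs with hx
    · exact spiderWeighing_spiderEdge φ hx
    · rw [not_ne_iff.1 hx]; rfl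
  · intro x hx y hy hxy
    exact spiderEdge_injective φ (by simpa using hx) (by simpa using hy) hxy

/-- A connected subgraph of the spider that contains a vertex beyond the path of the leg `i` and
some vertex outside of this leg contains the whole path of this leg. -/
theorem spiderEdge_mem_of_connected {H : (spider φ).2.Subgraph} (hH : H.Connected) {i : J}
    {x y : SpiderVertex ℓ t} (hx : φ.symm x ∈ H.verts) (hy : φ.symm y ∈ H.verts)
    (hxi : x ∈ legFrom i (ℓ i)) (hyi : y ∉ legFrom i 0) (q : Fin (ℓ i)) :
    spiderEdge φ (some ⟨i, q.castAdd t⟩) ∈ H.edgeSet := by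
  obtain ⟨a, b, hab, ha, hb⟩ := exists_adj_boundary hH (φ ⁻¹' legFrom i q) hx hy
    (by obtain ⟨r, hr, hqr⟩ := hxi; exact ⟨r, by simpa using hr, by omega⟩)
    (fun ⟨r, hr, _⟩ => hyi ⟨r, by simpa using hr, Nat.zero_le _⟩)
  rcases (parentGraph_adj (height_lt φ)).1 hab.adj_sub with ⟨-, rfl⟩ | ⟨-, rfl⟩
  · have h := eq_of_spiderParent_notMem_legFrom q.2 ha (by simpa using hb)
    have : spiderEdge φ (some ⟨i, q.castAdd t⟩) = s(a, φ.symm (spiderParent (φ a))) := by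
      rw [h, spiderEdge]
      congr 2
      rw [Equiv.symm_apply_eq, h]; rfl
    rw [this]
    exact hab
  · exact absurd (mem_legFrom_of_spiderParent (by simpa using ha)) hb

theorem isLocalPositive_spider (hts : t + 1 ≤ s) (hℓ : ∀ i j, i ≠ j → s ≤ ℓ i + ℓ j) :
    IsLocalPositive (t + s) (spider φ) (spiderWeighing φ) := by
  have hw : IsWeighing (spider φ) (spiderWeighing φ) := fun e _ => by
    unfold spiderWeighing
    split_ifs <;> simp
  refine ⟨hw, fun H hH hk => ?_⟩
  obtain ⟨S, hSH⟩ : ∃ S : Finset (Sym2 (Fin n)), (S : Set (Sym2 (Fin n))) = H.edgeSet :=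
    ⟨_, H.edgeSet.toFinite.coe_toFinset⟩
  have hmem : ∀ e, e ∈ S ↔ e ∈ H.edgeSet := fun e => by rw [← hSH, Finset.mem_coe]
  rw [← hSH, Set.ncard_coe_finset] at hk
  have hc := negCount_add_posCount (N := (spiderWeighing φ · = -1)) (S := S)
  rw [← hSH]
  have hwt : weight (spiderWeighing φ) (S : Set (Sym2 (Fin n))) =
      posCount (spiderWeighing φ · = -1) S - negCount (spiderWeighing φ · = -1) S :=
    weight_eq_posCount_sub_negCount fun e he => hw e (H.edgeSet_subset ((hmem e).1 he))
  refine lt_of_lt_of_eq ?_ hwt.symm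
  suffices h : negCount (spiderWeighing φ · = -1) S ≤ t ∨
      s ≤ posCount (spiderWeighing φ · = -1) S by omega
  -- Each negative edge of `H` lies at a leaf of some leg.
  have hneg : ∀ e ∈ S, spiderWeighing φ e = -1 →
      ∃ i, ∃ r : Fin t, e = spiderEdge φ (some ⟨i, r.natAdd (ℓ i)⟩) := by
    intro e he hwe
    obtain ⟨x, hx, rfl⟩ : e ∈ spiderEdge φ '' {x | x ≠ none} :=
      edgeSet_spider φ ▸ H.edgeSet_subset ((hmem e).1 he)
    rw [spiderWeighing_spiderEdge φ hx] at hwe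
    obtain ⟨⟨j, r⟩, rfl⟩ := Option.ne_none_iff_exists'.1 hx
    simp only [spiderWeight] at hwe
    refine ⟨j, ⟨r - ℓ j, by omega⟩, ?_⟩
    congr 3
    ext
    simp only [Fin.natAdd_mk]
    split_ifs at hwe
    omega
  by_cases hex : ∃ e ∈ S, spiderWeighing φ e = -1
  swap
  · left
    rw [negCount, Finset.filter_eq_empty_iff.2 fun e he hwe => hex ⟨e, he, hwe⟩]
    simp
  obtain ⟨e₁, he₁, hwe₁⟩ := hex
  obtain ⟨i, r₁, rfl⟩ := hneg e₁ he₁ hwe₁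
  by_cases hone : ∀ e ∈ S, spiderWeighing φ e = -1 →
      ∃ r : Fin t, e = spiderEdge φ (some ⟨i, r.natAdd (ℓ i)⟩)
  · left
    calc negCount (spiderWeighing φ · = -1) S
        ≤ ((Finset.univ : Finset (Fin t)).image fun r =>
            spiderEdge φ (some ⟨i, r.natAdd (ℓ i)⟩)).card := by
          refine Finset.card_le_card fun e he => ?_
          obtain ⟨r, rfl⟩ := hone e (Finset.mem_filter.1 he).1 (Finset.mem_filter.1 he).2
          exact Finset.mem_image_of_mem _ (Finset.mem_univ r)
      _ ≤ t := Finset.card_image_le.trans (by simp)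
  -- `H` contains leaves of two legs, hence the paths of both of them.
  · right
    push Not at hone
    obtain ⟨e₂, he₂, hwe₂, hne⟩ := hone
    obtain ⟨j, r₂, rfl⟩ := hneg e₂ he₂ hwe₂
    have hij : i ≠ j := by
      rintro rfl
      exact hne r₂ rfl
    have hvert : ∀ x, spiderEdge φ x ∈ S → φ.symm x ∈ H.verts := fun x hx =>
      H.mem_verts_of_mem_edge ((hmem _).1 hx) (Sym2.mem_mk_left _ _)
    have hpi := spiderEdge_mem_of_connected φ hH (i := i) (hvert _ he₁) (hvert _ he₂)
      ⟨_, rfl, by simp⟩ (by rintro ⟨r, hr, -⟩; simp [hij.symm] at hr)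
    have hpj := spiderEdge_mem_of_connected φ hH (i := j) (hvert _ he₂) (hvert _ he₁)
      ⟨_, rfl, by simp⟩ (by rintro ⟨r, hr, -⟩; simp [hij] at hr)
    let f : Fin (ℓ i) ⊕ Fin (ℓ j) → Σ j : J, Fin (ℓ j + t) :=
      Sum.elim (fun q => ⟨i, q.castAdd t⟩) (fun q => ⟨j, q.castAdd t⟩)
    have hf : Function.Injective f := by
      rintro (a | a) (b | b) hab
      · simpa [f] using hab
      · simp [f, hij] at hab
      · simp [f, hij.symm] at hab
      · simpa [f] using hab
    have hinj : Function.Injective fun a => spiderEdge φ (some (f a)) := fun a b hab =>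
      hf (Option.some_injective _ (spiderEdge_injective φ (by simp) (by simp) hab))
    calc s ≤ ℓ i + ℓ j := hℓ i j hij
      _ = (Finset.univ.image fun a => spiderEdge φ (some (f a))).card := by
          rw [Finset.card_image_of_injective _ hinj]; simp
      _ ≤ _ := by
          refine Finset.card_le_card fun e he => ?_
          obtain ⟨a, -, rfl⟩ := Finset.mem_image.1 he
          have hwe := spiderWeighing_spiderEdge φ (x := some (f a)) (by simp)
          refine Finset.mem_filter.2 ⟨(hmem _).2 ?_, ?_⟩
          · rcases a with a | a
            exacts [hpi a, hpj a]
          · change ¬ spiderWeighing φ (spiderEdge φ (some (f a))) = -1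
            rw [hwe]
            rcases a with a | a <;> simp [f, spiderWeight, not_le.2 a.2]

theorem exists_spider [Fintype J] (ℓ : J → ℕ) (hts : t + 1 ≤ s)
    (hℓ : ∀ i j, i ≠ j → s ≤ ℓ i + ℓ j) :
    ∃ G ∈ trees, ∃ w, IsLocalPositive (t + s) G w ∧ numEdges G = ∑ j, (ℓ j + t) ∧
      weight w G.2.edgeSet = ∑ j, ((ℓ j : ℤ) - t) :=
  let φ := (Fintype.equivFin (SpiderVertex ℓ t)).symm
  ⟨spider φ, spider_mem_trees φ, spiderWeighing φ, isLocalPositive_spider φ hts hℓ,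
    numEdges_spider φ, weight_spider φ⟩

end Spider

/-- A spider with `d` legs whose paths have `⌈s / 2⌉` edges and a further one whose path has
`⌊s / 2⌋` edges. -/
theorem exists_spider_weight {k t s : ℕ} (hk : k = t + s) (hts : t + 1 ≤ s) (d : ℕ) :
    ∃ G ∈ trees, ∃ w, IsLocalPositive k G w ∧
      numEdges G = d * ((s + 1) / 2 + t) + (s / 2 + t) ∧
      weight w G.2.edgeSet = d * (((s + 1) / 2 : ℕ) - (t : ℤ)) + ((s / 2 : ℕ) - (t : ℤ)) := by
  subst hk
  obtain ⟨G, hG, w, hw, hE, hW⟩ := exists_spider (t := t) (s := s)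
    (fun j : Option (Fin d) => j.elim (s / 2) fun _ => (s + 1) / 2) hts (by
      rintro (_ | i) (_ | j) hij <;> simp at hij ⊢ <;> omega)
  refine ⟨G, hG, w, hw, ?_, ?_⟩
  · rw [hE, Fintype.sum_option]; simp [add_comm]
  · rw [hW, Fintype.sum_option]; simp; ring
/-! ### Forcing, weak forcing and collapse -/

section Forcing

variable {𝒢 : Set FinGraph} {k t s : ℕ}

/-- If `s` is `2 * t` or `2 * t - 1`, the bound for large connected graphs is attained by spiders:
their long legs have weight `0`, and the remaining leg has weight `s - 2 * t`. -/
theorem weaklyForcing_and_isForcingConstant (hT : trees ⊆ 𝒢) (hC : 𝒢 ⊆ connectedGraphs)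
    (hk : k = t + s) (hst : s ≤ t + 2) (hs : s ≤ 2 * t) (hts : 2 * t ≤ s + 1) (ht : t + 1 ≤ s) :
    WeaklyForcing 𝒢 k ∧ IsForcingConstant 𝒢 k ((s : ℝ) - 2 * t) := by
  have hbdd : BoundedBelowBy 𝒢 k ((s : ℝ) - 2 * t) := finite_of_numEdges_lt hC k
    fun G hG hE w hw => by exact_mod_cast hw.le_weight hG hE hk hst hs hts ht
  have hspider : ∀ M : ℕ, ∃ G ∈ trees, M ≤ numEdges G ∧
      ∃ w, IsLocalPositive k G w ∧ weight w G.2.edgeSet = (s : ℤ) - 2 * t := by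
    intro M
    obtain ⟨G, hG, w, hw, hE, hW⟩ := exists_spider_weight hk ht M
    obtain rfl : t = (s + 1) / 2 := by omega
    refine ⟨G, hG, ?_, w, hw, ?_⟩
    · rw [hE]
      have := Nat.le_mul_of_pos_right M (show 0 < (s + 1) / 2 + (s + 1) / 2 by omega)
      omega
    · rw [hW, sub_self, mul_zero, zero_add]
      omega
  refine ⟨⟨?_, _, hbdd⟩, hbdd, fun C' hC' => ?_⟩
  · refine infinite_of_trees hT fun M => ?_
    obtain ⟨G, hG, hM, w, hw, hW⟩ := hspider M
    exact ⟨G, hG, hM, fun h => by have := h w hw; omega⟩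
  · by_contra! hlt
    refine infinite_of_trees hT (fun M => ?_) hC'
    obtain ⟨G, hG, hM, w, hw, hW⟩ := hspider M
    refine ⟨G, hG, hM, fun h => ?_⟩
    have := h w hw
    rw [hW] at this
    push_cast at this
    linarith

theorem collapses_of_lt (hT : trees ⊆ 𝒢) (hk : k = t + s) (hts : t + 1 ≤ s)
    (hlt : (s + 1) / 2 < t) : Collapses 𝒢 k := by
  have key : ∀ C : ℝ, ¬ BoundedBelowBy 𝒢 k C := by
    intro C
    refine infinite_of_trees hT fun M => ?_
    obtain ⟨K, hK⟩ := exists_nat_gt (-C)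
    obtain ⟨G, hG, w, hw, hE, hW⟩ := exists_spider_weight hk hts (M + K)
    refine ⟨G, hG, ?_, fun h => ?_⟩
    · rw [hE]
      have := Nat.le_mul_of_pos_right (M + K) (show 0 < (s + 1) / 2 + t by omega)
      omega
    · have hC := h w hw
      have : weight w G.2.edgeSet ≤ -(K : ℤ) := by
        rw [hW]
        have h1 : (((s + 1) / 2 : ℕ) : ℤ) - t ≤ -1 := by omega
        have h2 : ((s / 2 : ℕ) : ℤ) - t ≤ 0 := by omega
        have := mul_le_mul_of_nonneg_left h1 (Int.natCast_nonneg (M + K))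
        have e : ((M + K : ℕ) : ℤ) = M + K := Nat.cast_add _ _
        rw [e] at this ⊢
        linarith
      have : (weight w G.2.edgeSet : ℝ) ≤ -K := by exact_mod_cast this
      linarith
  refine ⟨fun hf => key 0 (hf.subset fun G hG => ⟨hG.1, fun h => hG.2 fun w hw => ?_⟩),
    fun hw => hw.2.elim key⟩
  exact_mod_cast (h w hw).le

/-- The average weight of the edges of a spider with many legs is an upper bound for the collapse
constant. -/
theorem collapseConstant_le (hT : trees ⊆ 𝒢) (hk : k = t + s) (hts : t + 1 ≤ s) :
    collapseConstant 𝒢 k ≤ (((s + 1) / 2 : ℕ) - (t : ℝ)) / (((s + 1) / 2 : ℕ) + t) := by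
  refine (isLUB_collapseConstant 𝒢 k).2 ?_
  rintro c ⟨-, h, ho, hb⟩
  by_contra! hlt
  set a : ℝ := (((s + 1) / 2 : ℕ) : ℝ) with ha
  have hposN : 0 < (s + 1) / 2 := by omega
  have hpos : 0 < a + t := by positivity
  rw [div_lt_iff₀ hpos] at hlt
  obtain ⟨ε, hε, hεc⟩ : ∃ ε > 0, a - t < (c - ε) * (a + t) := by
    refine ⟨(c * (a + t) - (a - t)) / (2 * (a + t)), by
      apply div_pos <;> linarith, ?_⟩
    have : (c * (a + t) - (a - t)) / (2 * (a + t)) * (a + t) = (c * (a + t) - (a - t)) / 2 := by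
      field_simp
    rw [sub_mul, this]
    linarith
  obtain ⟨M, hM⟩ := eventually_atTop.1 (ho.bound hε)
  -- A spider with sufficiently many legs violates the bound with `c - ε`.
  obtain ⟨K, hK⟩ := exists_nat_gt
    ((((s / 2 : ℕ) : ℝ) - t - (c - ε) * ((s / 2 : ℕ) + t)) / ((c - ε) * (a + t) - (a - t)))
  obtain ⟨G, hG, w, hw, hE, hW⟩ := exists_spider_weight hk hts (M + K)
  have hME : M ≤ numEdges G := by
    rw [hE]
    have := Nat.le_mul_of_pos_right (M + K) (show 0 < (s + 1) / 2 + t by omega)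
    omega
  have h1 := hb G (hT hG) w hw
  have h2 := (le_abs_self _).trans (hM _ hME)
  rw [Real.norm_natCast] at h2
  have hE' : (numEdges G : ℝ) = (M + K) * (a + t) + ((s / 2 : ℕ) + t) := by
    rw [hE, ha]; push_cast; rfl
  have hW' : (weight w G.2.edgeSet : ℝ) = (M + K) * (a - t) + ((s / 2 : ℕ) - t) := by
    rw [hW, ha]; push_cast; rfl
  have h3 : (c - ε) * numEdges G ≤ weight w G.2.edgeSet := by linarith
  rw [hE', hW'] at h3
  rw [div_lt_iff₀ (by linarith)] at hK
  have h4 : 0 ≤ (M : ℝ) * ((c - ε) * (a + t) - (a - t)) :=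
    mul_nonneg M.cast_nonneg (by linarith)
  linarith

theorem le_collapseConstant (hC : 𝒢 ⊆ connectedGraphs) (hk : k = t + s) (hst : s ≤ t + 2)
    (ht : 1 ≤ t) (hs : s ≤ 2 * t) :
    ((s : ℝ) - 2 * t) / (s + 2 * t) ≤ collapseConstant 𝒢 k :=
  (isLUB_collapseConstant 𝒢 k).1 (mem_linearBounds hC hk hst ht hs)

end Forcing

end FinGraph

theorem theorem1 (𝒢 : Set FinGraph) (hT : FinGraph.trees ⊆ 𝒢)
    (hC : 𝒢 ⊆ FinGraph.connectedGraphs) :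
    (FinGraph.Forcing 𝒢 1 ∧ FinGraph.Forcing 𝒢 2 ∧ FinGraph.Forcing 𝒢 4) ∧
    ((FinGraph.WeaklyForcing 𝒢 3 ∧ FinGraph.IsForcingConstant 𝒢 3 0) ∧
      (FinGraph.WeaklyForcing 𝒢 5 ∧ FinGraph.IsForcingConstant 𝒢 5 (-1)) ∧
      (FinGraph.WeaklyForcing 𝒢 6 ∧ FinGraph.IsForcingConstant 𝒢 6 0) ∧
      (FinGraph.WeaklyForcing 𝒢 8 ∧ FinGraph.IsForcingConstant 𝒢 8 (-1))) ∧
    (∀ k : ℕ, k = 7 ∨ 9 ≤ k →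
      FinGraph.Collapses 𝒢 k ∧
      ∀ m : ℕ,
        (k = 4 * m + 3 →
          FinGraph.collapseConstant 𝒢 k = -((m : ℝ) / (3 * (m : ℝ) + 2))) ∧
        (k = 4 * m + 2 →
          FinGraph.collapseConstant 𝒢 k = -(((m : ℝ) - 1) / (3 * (m : ℝ) + 1))) ∧
        (k = 4 * m + 1 →
          FinGraph.collapseConstant 𝒢 k ≤ -(((m : ℝ) - 1) / (3 * (m : ℝ) + 1)) ∧
          -((2 * (m : ℝ) - 1) / (6 * (m : ℝ) + 1)) ≤ FinGraph.collapseConstant 𝒢 k) ∧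
        (k = 4 * m →
          FinGraph.collapseConstant 𝒢 k ≤ -(((m : ℝ) - 2) / (3 * (m : ℝ))) ∧
          -((2 * (m : ℝ) - 3) / (6 * (m : ℝ) - 1)) ≤ FinGraph.collapseConstant 𝒢 k)) := by
  refine ⟨⟨?_, ?_, ?_⟩, ⟨?_, ?_, ?_, ?_⟩, fun k hk => ⟨?_, fun m => ⟨?_, ?_, ?_, ?_⟩⟩⟩
  · exact FinGraph.finite_of_numEdges_lt hC 1 fun G hG hE w hw =>
      hw.weight_pos_of_le_two le_rfl (by norm_num) hG hE
  · exact FinGraph.finite_of_numEdges_lt hC 2 fun G hG hE w hw =>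
      hw.weight_pos_of_le_two (by norm_num) le_rfl hG hE
  · exact FinGraph.finite_of_numEdges_lt hC 7 fun G hG hE w hw => hw.weight_pos_of_four hG hE
  · convert FinGraph.weaklyForcing_and_isForcingConstant (k := 3) (t := 1) (s := 2) hT hC rfl
      (by norm_num) (by norm_num) (by norm_num) (by norm_num) using 2
    norm_num
  · convert FinGraph.weaklyForcing_and_isForcingConstant (k := 5) (t := 2) (s := 3) hT hC rfl
      (by norm_num) (by norm_num) (by norm_num) (by norm_num) using 2
    norm_num
  · convert FinGraph.weaklyForcing_and_isForcingConstant (k := 6) (t := 2) (s := 4) hT hC rfl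
      (by norm_num) (by norm_num) (by norm_num) (by norm_num) using 2
    norm_num
  · convert FinGraph.weaklyForcing_and_isForcingConstant (k := 8) (t := 3) (s := 5) hT hC rfl
      (by norm_num) (by norm_num) (by norm_num) (by norm_num) using 2
    norm_num
  · exact FinGraph.collapses_of_lt (t := (k - 1) / 2) (s := k - (k - 1) / 2) hT
      (by omega) (by omega) (by omega)
  · rintro rfl
    have hdiv : (2 * m + 2 + 1) / 2 = m + 1 := by omega
    have hpos : (0 : ℝ) < 3 * m + 2 := by positivity
    refine le_antisymm ?_ ?_
    · refine (FinGraph.collapseConstant_le (t := 2 * m + 1) (s := 2 * m + 2) hT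
        (by omega) (by omega)).trans_eq ?_
      rw [hdiv, ← neg_div]
      push_cast
      rw [div_eq_div_iff (by positivity) hpos.ne']
      ring
    · refine (Eq.le ?_).trans (FinGraph.le_collapseConstant (t := 2 * m + 1) (s := 2 * m + 2) hC
        (by omega) (by omega) (by omega) (by omega))
      push_cast
      rw [← neg_div, div_eq_div_iff hpos.ne' (by positivity)]
      ring
  · rintro rfl
    have hdiv : (2 * m + 2 + 1) / 2 = m + 1 := by omega
    have hpos : (0 : ℝ) < 3 * m + 1 := by positivity
    refine le_antisymm ?_ ?_
    · refine (FinGraph.collapseConstant_le (t := 2 * m) (s := 2 * m + 2) hT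
        (by omega) (by omega)).trans_eq ?_
      rw [hdiv, ← neg_div]
      push_cast
      rw [div_eq_div_iff (by positivity) hpos.ne']
      ring
    · refine (Eq.le ?_).trans (FinGraph.le_collapseConstant (t := 2 * m) (s := 2 * m + 2) hC
        (by omega) (by omega) (by omega) (by omega))
      push_cast
      rw [← neg_div, div_eq_div_iff hpos.ne' (by positivity)]
      ring
  · rintro rfl
    have hdiv : (2 * m + 1 + 1) / 2 = m + 1 := by omega
    have hpos : (0 : ℝ) < 3 * m + 1 := by positivity
    constructor
    · refine (FinGraph.collapseConstant_le (t := 2 * m) (s := 2 * m + 1) hT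
        (by omega) (by omega)).trans_eq ?_
      rw [hdiv, ← neg_div]
      push_cast
      rw [div_eq_div_iff (by positivity) hpos.ne']
      ring
    · refine (Eq.le ?_).trans (FinGraph.le_collapseConstant (t := 2 * m) (s := 2 * m + 1) hC
        (by omega) (by omega) (by omega) (by omega))
      push_cast
      rw [← neg_div, div_eq_div_iff (by positivity) (by positivity)]
      ring
  · rintro rfl
    obtain ⟨m, rfl⟩ : ∃ m', m = m' + 1 := ⟨m - 1, by omega⟩
    have hdiv : (2 * m + 3 + 1) / 2 = m + 2 := by omega
    have hpos : (0 : ℝ) < 6 * (m + 1) - 1 := by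
      have : (0 : ℝ) ≤ m := m.cast_nonneg
      linarith
    constructor
    · refine (FinGraph.collapseConstant_le (t := 2 * m + 1) (s := 2 * m + 3) hT
        (by omega) (by omega)).trans_eq ?_
      rw [hdiv, ← neg_div]
      push_cast
      rw [div_eq_div_iff (by positivity) (by positivity)]
      ring
    · refine (Eq.le ?_).trans (FinGraph.le_collapseConstant (t := 2 * m + 1) (s := 2 * m + 3) hC
        (by omega) (by omega) (by omega) (by omega))
      push_cast
      rw [← neg_div, div_eq_div_iff hpos.ne' (by positivity)]
      ring
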